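/- Let $L,H,\kappa,\varepsilon_+,\varepsilon_->0$ and $\theta\in\mathbb R$, and put $\Omega=(0,L)\times(-H,H)$, $\alpha_n=\kappa\sqrt{\varepsilon_+}\sin\theta+2\pi n/L$ for $n\in\mathbb Z$, and $$\beta_n^\pm=\begin{cases}\sqrt{\kappa^2\varepsilon_\pm-\alpha_n^2}, & \alpha_n^2<\kappa^2\varepsilon_\pm,\\ i\sqrt{\alpha_n^2-\kappa^2\varepsilon_\pm}, & \alpha_n^2\ge\kappa^2\varepsilon_\pm.\end{cases}$$ Let $H^1_{qp}(\Omega)$ be the completion, in the norm $\|w\|_{H^1(\Omega)}=(\|w\|_{L^2(\Omega)}^2+|w|_{H^1(\Omega)}^2)^{1/2}$ with $|w|_{H^1(\Omega)}=\|\nabla w\|_{L^2(\Omega)}$, of the (restrictions to $\Omega$ of) functions $\varphi\in C^\infty(\mathbb R^2;\mathbb C)$ with $\varphi(x_1+L,x_2)=e^{i\alpha_0L}\varphi(x_1,x_2)$. For $w\in H^1_{qp}(\Omega)$ let $w_n(\pm H)=\frac1L\int_0^L w(x_1,\pm H)e^{-i\alpha_nx_1}\,dx_1$ be the Fourier coefficients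 of its traces on $\Gamma_{\pm H}=(0,L)\times\{\pm H\}$, let $T^\pm w=\frac{i}{\varepsilon_\pm}\sum_{n}\beta_n^\pm w_n(\pm H)e^{i\alpha_nx_1}$ be the Dirichlet-to-Neumann operators, with the boundary integrals understood as duality pairings $$\int_{\Gamma_{\pm H}}\overline v\,T^\pm(w)=L\,\frac{i}{\varepsilon_\pm}\sum_{n\in\mathbb Z}\beta_n^\pm\,w_n(\pm H)\,\overline{v_n(\pm H)},$$ and for $\varepsilon\in L^\infty(\Omega;\mathbb C)$ with $1/\varepsilon\in L^\infty(\Omega;\mathbb C)$ let $$B_\varepsilon(w,v)=\int_\Omega\Big(\frac1\varepsilon\nabla w\cdot\nabla\overline v-\kappa^2w\overline v\Big)-\int_{\Gamma_{-H}}\overline v\,T^-(w)-\int_{\Gamma_H}\overline v\,T^+(w),\qquad w,v\in H^1_{qp}(\Omega).$$ Then the series defining the boundary integrals converge absolutely for all $w,v\in H^1_{qp}(\Omega)$, and there is a constant $C>0$, depending only on $L,H,\kappa,\varepsilon_+,\varepsilon_-,\theta$, such that $$\|w\|_{L^2(\Omega)}^2\le C\Big(|w|_{H^1(\Omega)}^2+\operatorname{Im}\int_{\Gamma_H}\overline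 w\,T^+(w)\Big)\qquad\text{for all }w\in H^1_{qp}(\Omega),$$ and such that the following holds. Let $\varepsilon\in L^\infty(\Omega;\mathbb C)$ satisfy $\operatorname{Im}\varepsilon>c_1$ and $\operatorname{Re}\varepsilon>c_2$ a.e. in $\Omega$ for some constants $c_1,c_2>0$. Then $B_\varepsilon$ is coercive on $H^1_{qp}(\Omega)$: there is $c>0$ with $|B_\varepsilon(w,w)|\ge c\|w\|_{H^1(\Omega)}^2$ for all $w\in H^1_{qp}(\Omega)$. More precisely, with $$\sigma=\operatorname*{ess\,inf}_\Omega\min\Big(\frac{\operatorname{Re}\varepsilon}{|\varepsilon|^2},1\Big),\qquad \lambda=\frac1C\operatorname*{ess\,inf}_\Omega\min\Big(\frac{\operatorname{Im}\varepsilon}{|\varepsilon|^2},1\Big),\qquad \gamma=\kappa^2+1,$$ one has $\sigma>0$, $\lambda>0$ and $$|B_\varepsilon(w,w)|\ge\frac{\sigma}{\sqrt{1+2(\gamma/\lambda)^2}}\,\|w\|_{H^1(\Omega)}^2\qquad\text{for all }w\in H^1_{qp}(\Omega).$$ -/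

import Mathlib

open MeasureTheory
open scoped ENNReal ContDiff ComplexConjugate

noncomputable section

namespace RCWA

/-- The parameters of the scattering problem: the period `L` of the grating, the half-height `H`
of the computational cell, the wavenumber `κ`, the constant relative permittivities above and below
the cell, and the angle of incidence `θ`. -/
structure Setup where
  L : ℝ
  H : ℝ
  κ : ℝ
  epsTop : ℝ
  epsBot : ℝ
  θ : ℝ
  L_pos : 0 < L
  H_pos : 0 < H
  κ_pos : 0 < κ
  epsTop_pos : 0 < epsTop
  epsBot_pos : 0 < epsBot

namespace Setup

variable (S : Setup)

/-- The cell `Ω = (0, L) × (-H, H)`. -/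
def cell : Set (ℝ × ℝ) := Set.Ioo 0 S.L ×ˢ Set.Ioo (-S.H) S.H

/-- Lebesgue measure on `Ω`. -/
abbrev cellMeasure : Measure (ℝ × ℝ) := volume.restrict S.cell

/-- Lebesgue measure on `(0, L)`, which parametrizes the horizontal sections of `Ω`. -/
abbrev lineMeasure : Measure ℝ := volume.restrict (Set.Ioo 0 S.L)

/-- `αₙ = κ √ε₊ sin θ + 2πn / L`. -/
def alpha (n : ℤ) : ℝ := S.κ * √S.epsTop * Real.sin S.θ + n * (2 * Real.pi / S.L)

/-- `Lᵖ` membership, for every `p`, of continuous functions on the bounded set `Ω`. -/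
theorem memLp_cell {f : ℝ × ℝ → ℂ} (hf : Continuous f) (p : ℝ≥0∞) : MemLp f p S.cellMeasure := by
  have hK : IsCompact (Set.Icc (0 : ℝ) S.L ×ˢ Set.Icc (-S.H) S.H) :=
    isCompact_Icc.prod isCompact_Icc
  have hsub : S.cell ⊆ Set.Icc (0 : ℝ) S.L ×ˢ Set.Icc (-S.H) S.H :=
    Set.prod_mono Set.Ioo_subset_Icc_self Set.Ioo_subset_Icc_self
  have hm : MeasurableSet S.cell := measurableSet_Ioo.prod measurableSet_Ioo
  obtain ⟨C, hC⟩ := hK.exists_bound_of_continuousOn hf.continuousOn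
  have : IsFiniteMeasure S.cellMeasure :=
    ⟨by rw [Measure.restrict_apply_univ]; exact (measure_mono hsub).trans_lt hK.measure_lt_top⟩
  exact MemLp.of_bound hf.aestronglyMeasurable C
    ((ae_restrict_mem hm).mono fun x hx => hC x (hsub hx))

/-- `Lᵖ` membership of continuous functions on `(0, L)`. -/
theorem memLp_line {f : ℝ → ℂ} (hf : Continuous f) (p : ℝ≥0∞) : MemLp f p S.lineMeasure := by
  obtain ⟨C, hC⟩ := (isCompact_Icc (a := (0 : ℝ)) (b := S.L)).exists_bound_of_continuousOn
    hf.continuousOn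
  exact MemLp.of_bound hf.aestronglyMeasurable C
    ((ae_restrict_mem measurableSet_Ioo).mono fun x hx => hC x (Set.Ioo_subset_Icc_self hx))

/-- The smooth functions on the plane that are quasi-periodic in the first variable:
`φ (x₁ + L, x₂) = exp (i α₀ L) φ (x₁, x₂)`. -/
def smoothQP : Submodule ℂ (ℝ × ℝ → ℂ) where
  carrier := {φ | ContDiff ℝ ∞ φ ∧
    ∀ x y : ℝ, φ (x + S.L, y) = Complex.exp (Complex.I * S.alpha 0 * S.L) * φ (x, y)}
  add_mem' := by
    rintro φ ψ ⟨h1, h2⟩ ⟨h3, h4⟩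
    exact ⟨h1.add h3, fun x y => by simp only [Pi.add_apply, h2, h4]; ring⟩
  zero_mem' := ⟨contDiff_const, fun x y => by simp⟩
  smul_mem' := by
    rintro c φ ⟨h1, h2⟩
    exact ⟨h1.const_smul c, fun x y => by simp only [Pi.smul_apply, h2, smul_eq_mul]; ring⟩

variable {S} in
theorem smoothQP_differentiable (φ : S.smoothQP) : Differentiable ℝ (φ : ℝ × ℝ → ℂ) :=
  φ.2.1.differentiable (by simp)

variable {S} in
theorem smoothQP_continuous (φ : S.smoothQP) : Continuous (φ : ℝ × ℝ → ℂ) :=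
  φ.2.1.continuous

variable {S} in
theorem smoothQP_continuous_deriv (φ : S.smoothQP) (v : ℝ × ℝ) :
    Continuous fun p => fderiv ℝ (φ : ℝ × ℝ → ℂ) p v :=
  (φ.2.1.continuous_fderiv (by simp)).clm_apply continuous_const

/-- `L²(Ω)`. -/
abbrev L2Cell := Lp ℂ 2 S.cellMeasure

/-- `L²(Ω)³` with its Hilbert norm; `H¹(Ω)` embeds isometrically by `w ↦ (w, ∂₁w, ∂₂w)`. -/
abbrev L2Cell3 := PiLp 2 fun _ : Fin 3 => S.L2Cell

/-- The embedding `φ ↦ (φ, ∂₁φ, ∂₂φ)` of the smooth quasi-periodic functions into `L²(Ω)³`. The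
norm of the image is the `H¹(Ω)` norm of `φ`. -/
def jet : S.smoothQP →ₗ[ℂ] S.L2Cell3 where
  toFun φ := WithLp.toLp 2
    ![(S.memLp_cell (smoothQP_continuous φ) 2).toLp _,
      (S.memLp_cell (smoothQP_continuous_deriv φ (1, 0)) 2).toLp _,
      (S.memLp_cell (smoothQP_continuous_deriv φ (0, 1)) 2).toLp _]
  map_add' φ ψ := by
    ext1 i
    have h : ∀ v p, fderiv ℝ ((φ + ψ : S.smoothQP) : ℝ × ℝ → ℂ) p v =
        fderiv ℝ (φ : ℝ × ℝ → ℂ) p v + fderiv ℝ (ψ : ℝ × ℝ → ℂ) p v := fun v p => by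
      have := fderiv_add (smoothQP_differentiable φ p) (smoothQP_differentiable ψ p)
      exact congrArg (fun T => T v) this
    fin_cases i <;> simp <;> rw [← MemLp.toLp_add] <;> apply MemLp.toLp_congr
    · exact .of_forall (h _)
    · exact .of_forall (h _)
  map_smul' c φ := by
    ext1 i
    have h : ∀ v p, fderiv ℝ ((c • φ : S.smoothQP) : ℝ × ℝ → ℂ) p v =
        c • fderiv ℝ (φ : ℝ × ℝ → ℂ) p v := fun v p => by
      have := fderiv_const_smul (smoothQP_differentiable φ p) c
      exact congrArg (fun T => T v) this
    fin_cases i <;> simp <;> rw [← MemLp.toLp_const_smul] <;> apply MemLp.toLp_congr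
    · exact .of_forall (h _)
    · exact .of_forall (h _)

/-- `H¹_qp(Ω)`: the completion of the smooth quasi-periodic functions in the `H¹(Ω)` norm, realized
as the closure of their image in the Hilbert space `L²(Ω)³`. An element is a triple
`(w, ∂₁w, ∂₂w)`, and its norm is `(‖w‖² + ‖∂₁w‖² + ‖∂₂w‖²)^(1/2)`, the `H¹(Ω)` norm. -/
def H1qp : Submodule ℂ S.L2Cell3 := (LinearMap.range S.jet).topologicalClosure

/-- The smooth quasi-periodic functions as elements of `H¹_qp(Ω)`. -/
def ofSmooth : S.smoothQP →ₗ[ℂ] S.H1qp :=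
  S.jet.codRestrict S.H1qp fun φ => Submodule.le_topologicalClosure _ ⟨φ, rfl⟩

/-- The restriction of a smooth quasi-periodic function to the segment at height `s`. -/
def restrictLine (s : ℝ) : S.smoothQP →ₗ[ℂ] Lp ℂ 2 S.lineMeasure where
  toFun φ := (S.memLp_line (f := fun x => (φ : ℝ × ℝ → ℂ) (x, s))
    ((smoothQP_continuous φ).comp (by fun_prop)) 2).toLp _
  map_add' φ ψ := rfl
  map_smul' c φ := rfl

/-- The trace operator `H¹_qp(Ω) → L²(0, L)` at height `s ∈ [-H, H]`: the continuous extension of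
the restriction of smooth functions, see `trace_ofSmooth`. -/
def trace (s : ℝ) : S.H1qp →L[ℂ] Lp ℂ 2 S.lineMeasure := (S.restrictLine s).extendOfNorm S.ofSmooth

theorem denseRange_ofSmooth : DenseRange S.ofSmooth := by
  intro w
  rw [closure_subtype]
  have hw : (w : S.L2Cell3) ∈ closure (Set.range S.jet) := w.2
  refine closure_mono ?_ hw
  rintro _ ⟨φ, rfl⟩
  exact ⟨S.ofSmooth φ, ⟨φ, rfl⟩, rfl⟩

/-- One-dimensional trace inequality. -/
theorem sq_norm_le_integral {f g : ℝ → ℂ} (hf : ∀ t, HasDerivAt f (g t) t) (hg : Continuous g)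
    {h s : ℝ} (hs : s ∈ Set.Icc (-h) h) :
    2 * h * ‖f s‖ ^ 2 ≤ ∫ t in (-h)..h, ((1 + 2 * h) * ‖f t‖ ^ 2 + 2 * h * ‖g t‖ ^ 2) := by
  obtain ⟨hs1, hs2⟩ := hs
  have hfc : Continuous f := continuous_iff_continuousAt.2 fun t => (hf t).continuousAt
  have hder : ∀ c t, HasDerivAt (fun t => (t - c) * ‖f t‖ ^ 2)
      (‖f t‖ ^ 2 + (t - c) * (2 * inner ℝ (f t) (g t))) t := fun c t => by
    have h1 := ((hasDerivAt_id t).sub_const c).fun_mul (hf t).norm_sq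
    rw [one_mul] at h1
    exact h1
  have hcont : ∀ c, Continuous fun t => ‖f t‖ ^ 2 + (t - c) * (2 * inner ℝ (f t) (g t)) :=
    fun c => by fun_prop
  have hcont' : Continuous fun t => (1 + 2 * h) * ‖f t‖ ^ 2 + 2 * h * ‖g t‖ ^ 2 := by fun_prop
  have hle : ∀ c t, |t - c| ≤ 2 * h → ‖f t‖ ^ 2 + (t - c) * (2 * inner ℝ (f t) (g t)) ≤
      (1 + 2 * h) * ‖f t‖ ^ 2 + 2 * h * ‖g t‖ ^ 2 := fun c t hc => by
    have h1 : (t - c) * (2 * inner ℝ (f t) (g t)) ≤ |t - c| * (2 * (‖f t‖ * ‖g t‖)) := by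
      refine (le_abs_self _).trans ?_
      rw [abs_mul, abs_mul, abs_two]
      gcongr
      exact abs_real_inner_le_norm _ _
    have h2 : 2 * (‖f t‖ * ‖g t‖) ≤ ‖f t‖ ^ 2 + ‖g t‖ ^ 2 := by
      nlinarith [sq_nonneg (‖f t‖ - ‖g t‖)]
    have h3 : |t - c| * (2 * (‖f t‖ * ‖g t‖)) ≤ 2 * h * (‖f t‖ ^ 2 + ‖g t‖ ^ 2) :=
      mul_le_mul hc h2 (by positivity) ((abs_nonneg _).trans hc)
    nlinarith
  have e1 := intervalIntegral.integral_eq_sub_of_hasDerivAt (a := -h) (b := s)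
    (fun t _ => hder (-h) t) ((hcont _).intervalIntegrable _ _)
  have e2 := intervalIntegral.integral_eq_sub_of_hasDerivAt (a := s) (b := h)
    (fun t _ => hder h t) ((hcont _).intervalIntegrable _ _)
  have i1 := intervalIntegral.integral_mono_on (μ := volume) hs1 ((hcont (-h)).intervalIntegrable _ _)
    (hcont'.intervalIntegrable _ _) fun t ht => hle (-h) t (by
      rw [abs_le]; constructor <;> linarith [ht.1, ht.2])
  have i2 := intervalIntegral.integral_mono_on (μ := volume) hs2 ((hcont h).intervalIntegrable _ _)
    (hcont'.intervalIntegrable _ _) fun t ht => hle h t (by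
      rw [abs_le]; constructor <;> linarith [ht.1, ht.2])
  rw [← intervalIntegral.integral_add_adjacent_intervals (hcont'.intervalIntegrable (-h) s)
    (hcont'.intervalIntegrable s h)]
  nlinarith

theorem sq_norm_toLp {α : Type*} [MeasurableSpace α] {μ : Measure α} {f : α → ℂ}
    (hf : MemLp f 2 μ) : ‖hf.toLp f‖ ^ 2 = ∫ x, ‖f x‖ ^ 2 ∂μ := by
  rw [← inner_self_eq_norm_sq (𝕜 := ℂ), L2.inner_def, ← integral_re]
  · refine integral_congr_ae (hf.coeFn_toLp.mono fun x hx => ?_)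
    simp only [hx]
    rw [inner_self_eq_norm_sq (𝕜 := ℂ)]
  · exact L2.integrable_inner _ _

/-- The trace inequality for smooth functions. -/
theorem norm_restrictLine_le {s : ℝ} (hs : s ∈ Set.Icc (-S.H) S.H) :
    ∃ C, ∀ φ, ‖S.restrictLine s φ‖ ≤ C * ‖S.ofSmooth φ‖ := by
  have hH := S.H_pos
  refine ⟨√((1 + 2 * S.H) / (2 * S.H)), fun φ => ?_⟩
  refine abs_le_of_sq_le_sq' ?_ (by positivity) |>.2
  rw [mul_pow, Real.sq_sqrt (by positivity), div_mul_eq_mul_div, le_div_iff₀ (by positivity)]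
  set F : ℝ × ℝ → ℂ := (φ : ℝ × ℝ → ℂ)
  set G : ℝ × ℝ → ℂ := fun p => fderiv ℝ (φ : ℝ × ℝ → ℂ) p (0, 1)
  have hF : Continuous F := smoothQP_continuous φ
  have hG : Continuous G := smoothQP_continuous_deriv φ (0, 1)
  have hn : ‖S.ofSmooth φ‖ ^ 2 ≥
      (∫ p, ‖F p‖ ^ 2 ∂S.cellMeasure) + ∫ p, ‖G p‖ ^ 2 ∂S.cellMeasure := by
    have : ‖S.ofSmooth φ‖ ^ 2 = ‖S.jet φ‖ ^ 2 := rfl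
    rw [this, PiLp.norm_sq_eq_of_L2, Fin.sum_univ_three, ← sq_norm_toLp (S.memLp_cell hF 2),
      ← sq_norm_toLp (S.memLp_cell hG 2)]
    have h1 : (S.jet φ) 0 = (S.memLp_cell hF 2).toLp F := rfl
    have h2 : (S.jet φ) 2 = (S.memLp_cell hG 2).toLp G := rfl
    rw [h1, h2]
    nlinarith [sq_nonneg ‖(S.jet φ) 1‖]
  have hr : ‖S.restrictLine s φ‖ ^ 2 = ∫ x, ‖F (x, s)‖ ^ 2 ∂S.lineMeasure :=
    sq_norm_toLp (S.memLp_line (f := fun x => F (x, s)) (hF.comp (by fun_prop)) 2)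
  have hFi : Integrable (fun p => ‖F p‖ ^ 2) S.cellMeasure :=
    (memLp_two_iff_integrable_sq_norm hF.aestronglyMeasurable).1 (S.memLp_cell hF 2)
  have hGi : Integrable (fun p => ‖G p‖ ^ 2) S.cellMeasure :=
    (memLp_two_iff_integrable_sq_norm hG.aestronglyMeasurable).1 (S.memLp_cell hG 2)
  have hprod : S.cellMeasure = S.lineMeasure.prod (volume.restrict (Set.Ioo (-S.H) S.H)) := by
    rw [Measure.prod_restrict]; rfl
  have hI : Integrable (fun p => (1 + 2 * S.H) * ‖F p‖ ^ 2 + 2 * S.H * ‖G p‖ ^ 2) S.cellMeasure :=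
    (hFi.const_mul _).add (hGi.const_mul _)
  have key : 2 * S.H * ∫ x, ‖F (x, s)‖ ^ 2 ∂S.lineMeasure ≤
      ∫ p, ((1 + 2 * S.H) * ‖F p‖ ^ 2 + 2 * S.H * ‖G p‖ ^ 2) ∂S.cellMeasure := by
    rw [← integral_const_mul]
    rw [hprod] at hI ⊢
    rw [integral_prod _ hI]
    refine integral_mono_of_nonneg (.of_forall fun x => by positivity) hI.integral_prod_left
      (.of_forall fun x => ?_)
    have hd : ∀ t, HasDerivAt (fun t => F (x, t)) (G (x, t)) t := fun t => by
      have h1 : HasDerivAt (fun t : ℝ => (x, t)) ((0 : ℝ), (1 : ℝ)) t :=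
        (hasDerivAt_const t x).prodMk (hasDerivAt_id t)
      exact (smoothQP_differentiable φ (x, t)).hasFDerivAt.comp_hasDerivAt t h1
    have := sq_norm_le_integral hd (by fun_prop) hs
    rwa [intervalIntegral.integral_of_le (by linarith), integral_Ioc_eq_integral_Ioo] at this
  rw [integral_add (hFi.const_mul _) (hGi.const_mul _), integral_const_mul,
    integral_const_mul] at key
  have hG0 : 0 ≤ ∫ p, ‖G p‖ ^ 2 ∂S.cellMeasure := integral_nonneg fun p => by positivity
  rw [hr]
  nlinarith

/-- On smooth functions the trace is the restriction. -/
theorem trace_ofSmooth {s : ℝ} (hs : s ∈ Set.Icc (-S.H) S.H) (φ : S.smoothQP) :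
    S.trace s (S.ofSmooth φ) = S.restrictLine s φ :=
  LinearMap.extendOfNorm_eq S.denseRange_ofSmooth (S.norm_restrictLine_le hs) φ

variable {S}

/-- The function underlying an element of `H¹_qp(Ω)`. -/
def val (w : S.H1qp) : S.L2Cell := (w : S.L2Cell3) 0

/-- Its weak derivative in the horizontal variable. -/
def d1 (w : S.H1qp) : S.L2Cell := (w : S.L2Cell3) 1

/-- Its weak derivative in the vertical variable. -/
def d2 (w : S.H1qp) : S.L2Cell := (w : S.L2Cell3) 2

/-- The square of the `H¹(Ω)` seminorm. -/
def seminormSq (w : S.H1qp) : ℝ := ‖d1 w‖ ^ 2 + ‖d2 w‖ ^ 2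

theorem norm_sq_eq (w : S.H1qp) : ‖w‖ ^ 2 = ‖val w‖ ^ 2 + seminormSq w := by
  have : ‖w‖ ^ 2 = ‖(w : S.L2Cell3)‖ ^ 2 := rfl
  rw [this, PiLp.norm_sq_eq_of_L2, Fin.sum_univ_three, add_assoc]
  rfl

/-- The coefficient `wₙ(s)` in the expansion `w (x, s) = ∑ₙ wₙ(s) exp (i αₙ x)` of the trace of `w`
at height `s`. -/
def coeff (s : ℝ) (w : S.H1qp) (n : ℤ) : ℂ :=
  (S.L : ℂ)⁻¹ * ∫ x, S.trace s w x * Complex.exp (-(Complex.I * S.alpha n * x)) ∂S.lineMeasure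

variable (S) in
/-- The vertical wavenumber `βₙ` in a half-space of constant permittivity `e`. -/
def beta (e : ℝ) (n : ℤ) : ℂ :=
  if S.alpha n ^ 2 < S.κ ^ 2 * e then (√(S.κ ^ 2 * e - S.alpha n ^ 2) : ℝ)
  else Complex.I * (√(S.alpha n ^ 2 - S.κ ^ 2 * e) : ℝ)

/-- The coefficient of `exp (i αₙ x)` in `T w = (i / e) ∑ₙ wₙ(s) βₙ exp (i αₙ x)`, where `T` is the
Dirichlet-to-Neumann operator at height `s` for a half-space of constant permittivity `e`. -/
def dtnCoeff (e s : ℝ) (w : S.H1qp) (n : ℤ) : ℂ :=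
  Complex.I / e * (coeff s w n * S.beta e n)

/-- The terms of the series for the boundary integral of `T w` times the conjugate of `v`. -/
def dtnTerm (e s : ℝ) (w v : S.H1qp) (n : ℤ) : ℂ :=
  S.L * (dtnCoeff e s w n * conj (coeff s v n))

/-- The boundary integral of `T w` times the conjugate of `v` over the segment at height `s`. Since
`T w` is in general only a functional on `H^(1/2)` traces, this is the duality pairing; by the
orthogonality of the functions `exp (i αₙ x)` on `(0, L)` it is `L ∑ₙ (T w)ₙ conj vₙ(s)`. -/
def dtnForm (e s : ℝ) (w v : S.H1qp) : ℂ := ∑' n, dtnTerm e s w v n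

/-- The sesquilinear form `B_ε` on `H¹_qp(Ω)`. -/
def form (ε : ℝ × ℝ → ℂ) (w v : S.H1qp) : ℂ :=
  (∫ p, ((ε p)⁻¹ * (d1 w p * conj (d1 v p) + d2 w p * conj (d2 v p))
      - (S.κ : ℂ) ^ 2 * (val w p * conj (val v p))) ∂S.cellMeasure)
    - dtnForm S.epsBot (-S.H) w v - dtnForm S.epsTop S.H w v

/-- Coercivity of a form on a complex normed space. -/
def Coercive {V : Type*} [NormedAddCommGroup V] (B : V → V → ℂ) : Prop :=
  ∃ c : ℝ, 0 < c ∧ ∀ w, c * ‖w‖ ^ 2 ≤ ‖B w w‖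

variable (S) in
/-- `σ(ε) = min_Ω (Re ε / |ε|², 1)`. -/
def sigma (ε : ℝ × ℝ → ℂ) : ℝ :=
  essInf (fun p => min ((ε p).re / ‖ε p‖ ^ 2) 1) S.cellMeasure

variable (S) in
/-- `λ(ε) = c min_Ω (Im ε / |ε|², 1)`. -/
def lam (c : ℝ) (ε : ℝ × ℝ → ℂ) : ℝ :=
  c * essInf (fun p => min ((ε p).im / ‖ε p‖ ^ 2) 1) S.cellMeasure

variable (S) in
/-- `γ = κ² + 1`. -/
def gam : ℝ := S.κ ^ 2 + 1

end Setup

end RCWA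

end

/-!
On smooth quasi-periodic functions, Parseval's identity in the horizontal variable turns
`‖w‖²`, `‖∂₁w‖²` and `‖∂₂w‖²` into sums over the modes `wₙ(t)`, where `∂₁` acts as multiplication by
`i αₙ`. Applied to each mode, the one-dimensional trace inequality on an interval rescaled by
`1 + |αₙ|` gives `∑ (1 + |αₙ|) |wₙ(s)|² ≤ C ‖w‖²`; since `|βₙ| = O(1 + |αₙ|)`, the boundary series
converge absolutely.

For the Poincaré inequality put `δ = κ² ε₊ / 2`. Modes with `αₙ² ≥ δ` are controlled by `∂₁w`. The
others are controlled by `∂₂w` and the trace at height `H`, and there `Re βₙ ≥ √δ`, so that the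
trace is bounded by the imaginary part of the boundary integral. Both estimates extend to
`H¹_qp(Ω)` by density.

Taking real parts, `Re B(w, w) ≥ σ ‖w‖²_{H¹} - γ ‖w‖²_{L²}`, because the boundary integrals have
nonpositive real part. Their imaginary parts are nonnegative, so that the Poincaré inequality gives
`-Im B(w, w) ≥ λ ‖w‖²_{L²}`, and `γ / λ` times this absorbs the negative term.
-/

noncomputable section

namespace RCWA

/-! ### Inequalities on an interval -/

theorem mul_sq_norm_le_integral {f g : ℝ → ℂ} (hf : ∀ t, HasDerivAt f (g t) t)
    (hg : Continuous g) {a h s : ℝ} (ha : 0 < a) (hs : s ∈ Set.Icc (-h) h) :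
    2 * h * (a * ‖f s‖ ^ 2) ≤
      ∫ t in (-h)..h, ((a + 2 * h * a ^ 2) * ‖f t‖ ^ 2 + 2 * h * ‖g t‖ ^ 2) := by
  -- Rescale the unweighted trace inequality by `t ↦ t / a`.
  have hderiv : ∀ t, HasDerivAt (fun t => f (t / a)) (a⁻¹ • g (t / a)) t := fun t => by
    simpa only [one_div, Function.comp_def] using
      (hf (t / a)).scomp t ((hasDerivAt_id' t).div_const a)
  have hscaled : a * s ∈ Set.Icc (-(a * h)) (a * h) :=
    ⟨by nlinarith [hs.1], mul_le_mul_of_nonneg_left hs.2 ha.le⟩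
  have hbound := Setup.sq_norm_le_integral hderiv (by fun_prop) hscaled
  have hsubst := intervalIntegral.integral_comp_div (a := -(a * h)) (b := a * h)
    (fun t => (1 + 2 * (a * h)) * ‖f t‖ ^ 2 + 2 * (a * h) * ‖a⁻¹ • g t‖ ^ 2) ha.ne'
  rw [hsubst, mul_div_cancel_left₀ s ha.ne', ← mul_neg, mul_div_cancel_left₀ _ ha.ne',
    mul_div_cancel_left₀ _ ha.ne', smul_eq_mul, ← intervalIntegral.integral_const_mul] at hbound
  calc 2 * h * (a * ‖f s‖ ^ 2) = 2 * (a * h) * ‖f s‖ ^ 2 := by ring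
    _ ≤ _ := hbound
    _ = _ := by
      congr 1 with t
      rw [norm_smul, norm_inv, Real.norm_of_nonneg ha.le]
      field_simp

theorem one_add_abs_mul_sq_norm_le_integral {f g : ℝ → ℂ} (hf : ∀ t, HasDerivAt f (g t) t)
    (hg : Continuous g) {h s : ℝ} (hs : s ∈ Set.Icc (-h) h) (α : ℝ) :
    2 * h * ((1 + |α|) * ‖f s‖ ^ 2) ≤ (2 + 4 * h) *
      ((∫ t in (-h)..h, ‖f t‖ ^ 2) + (α ^ 2 * ∫ t in (-h)..h, ‖f t‖ ^ 2) +
        ∫ t in (-h)..h, ‖g t‖ ^ 2) := by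
  have hh : 0 ≤ h := by linarith [hs.1, hs.2]
  have hfc : Continuous f := continuous_iff_continuousAt.2 fun t => (hf t).continuousAt
  have hbound := mul_sq_norm_le_integral hf hg (a := 1 + |α|) (by positivity) hs
  rw [intervalIntegral.integral_add (Continuous.intervalIntegrable (by fun_prop) _ _)
    (Continuous.intervalIntegrable (by fun_prop) _ _), intervalIntegral.integral_const_mul,
    intervalIntegral.integral_const_mul] at hbound
  have hf0 : 0 ≤ ∫ t in (-h)..h, ‖f t‖ ^ 2 :=
    intervalIntegral.integral_nonneg (by linarith) fun t _ => by positivity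
  have hg0 : 0 ≤ ∫ t in (-h)..h, ‖g t‖ ^ 2 :=
    intervalIntegral.integral_nonneg (by linarith) fun t _ => by positivity
  have hweight : 1 + |α| + 2 * h * (1 + |α|) ^ 2 ≤ (2 + 4 * h) * (1 + α ^ 2) := by
    rw [← sq_abs α]
    nlinarith [sq_nonneg (|α| - 1), mul_nonneg hh (sq_nonneg (|α| - 1)), sq_nonneg |α|]
  nlinarith [mul_le_mul_of_nonneg_right hweight hf0, mul_nonneg hh hg0]

theorem integral_sq_norm_le_of_hasDerivAt {E : Type*} [NormedAddCommGroup E]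
    [InnerProductSpace ℝ E] {f g : ℝ → E} (hf : ∀ t, HasDerivAt f (g t) t) (hg : Continuous g)
    {a b : ℝ} (hab : a ≤ b) :
    ∫ t in a..b, ‖f t‖ ^ 2 ≤
      2 * (b - a) * ‖f b‖ ^ 2 + 4 * (b - a) ^ 2 * ∫ t in a..b, ‖g t‖ ^ 2 := by
  have hfc : Continuous f := continuous_iff_continuousAt.2 fun t => (hf t).continuousAt
  have hderiv : ∀ t, HasDerivAt (fun t => (t - a) * ‖f t‖ ^ 2)
      (‖f t‖ ^ 2 + (t - a) * (2 * inner ℝ (f t) (g t))) t := fun t => by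
    simpa only [one_mul] using ((hasDerivAt_id' t).sub_const a).fun_mul (hf t).norm_sq
  have hyoung : ∀ t ∈ Set.Icc a b, (1 / 2) * ‖f t‖ ^ 2 - 2 * (b - a) ^ 2 * ‖g t‖ ^ 2 ≤
      ‖f t‖ ^ 2 + (t - a) * (2 * inner ℝ (f t) (g t)) := fun t ht => by
    have hinner : (t - a) * -inner ℝ (f t) (g t) ≤ (b - a) * (‖f t‖ * ‖g t‖) :=
      calc (t - a) * -inner ℝ (f t) (g t) ≤ (t - a) * (‖f t‖ * ‖g t‖) :=
            mul_le_mul_of_nonneg_left ((neg_le_abs _).trans (abs_real_inner_le_norm _ _))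
              (sub_nonneg.2 ht.1)
        _ ≤ (b - a) * (‖f t‖ * ‖g t‖) := by gcongr; exact ht.2
    nlinarith [sq_nonneg (‖f t‖ - 2 * ((b - a) * ‖g t‖))]
  have hmono := intervalIntegral.integral_mono_on (μ := volume) hab
    (Continuous.intervalIntegrable (by fun_prop) _ _)
    (Continuous.intervalIntegrable (by fun_prop) _ _) hyoung
  rw [intervalIntegral.integral_eq_sub_of_hasDerivAt (fun t _ => hderiv t)
      (Continuous.intervalIntegrable (by fun_prop) _ _),
    intervalIntegral.integral_sub (Continuous.intervalIntegrable (by fun_prop) _ _)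
      (Continuous.intervalIntegrable (by fun_prop) _ _),
    intervalIntegral.integral_const_mul, intervalIntegral.integral_const_mul] at hmono
  linarith

theorem integral_deriv_mul_exp_of_quasiperiodic {f g : ℝ → ℂ}
    (hf : ∀ x, HasDerivAt f (g x) x) (hg : Continuous g) {α : ℂ} {L : ℝ}
    (hL : f L = Complex.exp (Complex.I * α * L) * f 0) :
    ∫ x in (0 : ℝ)..L, g x * Complex.exp (-(Complex.I * α * x)) =
      Complex.I * α * ∫ x in (0 : ℝ)..L, f x * Complex.exp (-(Complex.I * α * x)) := by
  have hfc : Continuous f := continuous_iff_continuousAt.2 fun x => (hf x).continuousAt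
  have hexp : ∀ x : ℝ, HasDerivAt (fun x : ℝ => Complex.exp (-(Complex.I * α * x)))
      (-(Complex.I * α) * Complex.exp (-(Complex.I * α * x))) x := fun x => by
    simpa [mul_comm] using
      ((Complex.ofRealCLM.hasDerivAt (x := x)).const_mul (Complex.I * α)).fun_neg.cexp
  have hparts := intervalIntegral.integral_deriv_mul_eq_sub (a := 0) (b := L)
    (fun x _ => hf x) (fun x _ => hexp x) (Continuous.intervalIntegrable (by fun_prop) _ _)
    (Continuous.intervalIntegrable (by fun_prop) _ _)
  rw [intervalIntegral.integral_add (Continuous.intervalIntegrable (by fun_prop) _ _)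
    (Continuous.intervalIntegrable (by fun_prop) _ _), hL] at hparts
  have hboundary : Complex.exp (Complex.I * α * L) * f 0 * Complex.exp (-(Complex.I * α * L)) =
      f 0 * Complex.exp (-(Complex.I * α * (0 : ℝ))) := by
    rw [mul_right_comm, ← Complex.exp_add]
    simp
  rw [hboundary, sub_self] at hparts
  simp only [mul_left_comm (f _), intervalIntegral.integral_const_mul] at hparts
  linear_combination hparts

/-! ### Essential infima and complex moduli -/

section EssInf

variable {X : Type*} [MeasurableSpace X] {μ : Measure X} {f : X → ℝ} {c : ℝ}

theorem ae_essInf_min_one_le (hf : ∀ᵐ x ∂μ, c ≤ f x) :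
    ∀ᵐ x ∂μ, essInf (fun x => min (f x) 1) μ ≤ min (f x) 1 :=
  ae_essInf_le ⟨min c 1, hf.mono fun _ hx => min_le_min_right 1 hx⟩

theorem essInf_min_one_mem_Ioc [NeZero μ] (hc : 0 < c) (hf : ∀ᵐ x ∂μ, c ≤ f x) :
    essInf (fun x => min (f x) 1) μ ∈ Set.Ioc 0 1 := by
  have hcobounded : Filter.IsCoboundedUnder (· ≥ ·) (ae μ) fun x => min (f x) 1 :=
    (Filter.isBoundedUnder_of ⟨1, fun x => min_le_right _ _⟩).isCoboundedUnder_ge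
  obtain ⟨x, hx⟩ := (ae_essInf_min_one_le hf).exists
  exact ⟨(lt_min hc one_pos).trans_le (le_essInf_of_ae_le _
    (hf.mono fun _ hx => min_le_min_right 1 hx) hcobounded), hx.trans (min_le_right _ _)⟩

theorem exists_pos_ae_le_div_sq_norm {E : Type*} [NormedAddCommGroup E] {g : X → E}
    (hg : eLpNorm g ∞ μ ≠ ⊤) (hc : 0 < c) (hf : ∀ᵐ x ∂μ, c < f x) (hfg : ∀ x, f x ≤ ‖g x‖) :
    ∃ a, 0 < a ∧ ∀ᵐ x ∂μ, a ≤ f x / ‖g x‖ ^ 2 := by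
  set K := (eLpNorm g ∞ μ).toReal
  refine ⟨c / (K + 1) ^ 2, by positivity, ?_⟩
  rw [eLpNorm_exponent_top] at hg
  filter_upwards [hf, ae_le_eLpNormEssSup (f := g) (μ := μ)] with x hx hxK
  have hgK : ‖g x‖ ≤ K + 1 := by
    have := ENNReal.toReal_mono hg hxK
    rw [toReal_enorm, ← eLpNorm_exponent_top] at this
    linarith
  have hg0 : 0 < ‖g x‖ := hc.trans (hx.trans_le (hfg x))
  exact div_le_div₀ (hc.trans hx).le hx.le (by positivity) (pow_le_pow_left₀ hg0.le hgK 2)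

theorem memLp_top_inv_of_lt_norm {𝕜 : Type*} [RCLike 𝕜] {g : X → 𝕜}
    (hg : AEStronglyMeasurable g μ) (hc : 0 < c) (h : ∀ᵐ x ∂μ, c < ‖g x‖) :
    MemLp (fun x => (g x)⁻¹) ∞ μ :=
  memLp_top_of_bound hg.aemeasurable.inv.aestronglyMeasurable c⁻¹ <| h.mono fun x hx => by
    rw [norm_inv]
    exact inv_anti₀ hc hx.le

end EssInf

theorem div_sqrt_le_norm_of_le_re_sub_im {z : ℂ} {m r : ℝ} (hm : 0 ≤ m)
    (h : m ≤ z.re - r * z.im) : m / √(1 + 2 * r ^ 2) ≤ ‖z‖ := by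
  rw [div_le_iff₀ (by positivity)]
  refine le_of_sq_le_sq ?_ (by positivity)
  calc m ^ 2 ≤ (z.re - r * z.im) ^ 2 := pow_le_pow_left₀ hm h 2
    _ ≤ (z.re * z.re + z.im * z.im) * (1 + 2 * r ^ 2) := by
      nlinarith [sq_nonneg (r * z.re + z.im), sq_nonneg (r * z.re), sq_nonneg (r * z.im)]
    _ = (‖z‖ * √(1 + 2 * r ^ 2)) ^ 2 := by
      rw [mul_pow, Real.sq_sqrt (by positivity), ← Complex.normSq_eq_norm_sq,
        Complex.normSq_apply]

namespace Setup

/-! ### Fourier modes -/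

variable (S : Setup)

theorem integral_lineMeasure {E : Type*} [NormedAddCommGroup E] [NormedSpace ℝ E] (f : ℝ → E) :
    ∫ x, f x ∂S.lineMeasure = ∫ x in (0 : ℝ)..S.L, f x := by
  rw [intervalIntegral.integral_of_le S.L_pos.le, integral_Ioc_eq_integral_Ioo]

/-- The coefficient of `exp (i αₙ x)` in the quasi-periodic Fourier expansion of `f` on `(0, L)`. -/
def qpFourierCoeff (f : ℝ → ℂ) (n : ℤ) : ℂ :=
  (S.L : ℂ)⁻¹ * ∫ x, f x * Complex.exp (-(Complex.I * S.alpha n * x)) ∂S.lineMeasure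

theorem qpFourierCoeff_congr_ae {f g : ℝ → ℂ} (hfg : f =ᵐ[S.lineMeasure] g) (n : ℤ) :
    S.qpFourierCoeff f n = S.qpFourierCoeff g n := by
  unfold qpFourierCoeff
  congr 1
  exact integral_congr_ae (hfg.mono fun x hx => by simp only [hx])

theorem qpFourierCoeff_eq_fourierCoeffOn (f : ℝ → ℂ) (n : ℤ) :
    S.qpFourierCoeff f n =
      fourierCoeffOn S.L_pos (fun x => f x * Complex.exp (-(Complex.I * S.alpha 0 * x))) n := by
  have hL : (S.L : ℂ) ≠ 0 := by exact_mod_cast S.L_pos.ne'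
  rw [qpFourierCoeff, integral_lineMeasure, fourierCoeffOn_eq_integral, Complex.real_smul]
  push_cast
  rw [sub_zero, one_div]
  congr 2 with x
  rw [fourier_coe_apply, smul_eq_mul, mul_left_comm, ← Complex.exp_add]
  congr 2
  simp only [alpha]
  push_cast
  field_simp
  ring

theorem norm_exp_neg_I_mul_alpha (n : ℤ) (x : ℝ) :
    ‖Complex.exp (-(Complex.I * S.alpha n * x))‖ = 1 := by
  simp [Complex.norm_exp]

theorem hasSum_sq_norm_qpFourierCoeff {f : ℝ → ℂ} (hf : MemLp f 2 S.lineMeasure) :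
    HasSum (fun n => S.L * ‖S.qpFourierCoeff f n‖ ^ 2) (∫ x, ‖f x‖ ^ 2 ∂S.lineMeasure) := by
  have hmodulated : MemLp (fun x => f x * Complex.exp (-(Complex.I * S.alpha 0 * x))) 2
      (volume.restrict (Set.Ioc 0 S.L)) := by
    rw [← Measure.restrict_congr_set Ioo_ae_eq_Ioc]
    refine hf.congr_norm (hf.1.mul (Continuous.aestronglyMeasurable (by fun_prop)))
      (.of_forall fun x => ?_)
    rw [norm_mul, norm_exp_neg_I_mul_alpha, mul_one]
  have hparseval := (hasSum_sq_fourierCoeffOn S.L_pos hmodulated).mul_left S.L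
  simp only [← qpFourierCoeff_eq_fourierCoeffOn, norm_mul, norm_exp_neg_I_mul_alpha, mul_one,
    sub_zero, smul_eq_mul, mul_inv_cancel_left₀ S.L_pos.ne'] at hparseval
  rwa [integral_lineMeasure]

theorem continuous_qpFourierCoeff (n : ℤ) :
    Continuous fun f : Lp ℂ 2 S.lineMeasure => S.qpFourierCoeff f n := by
  have hexp : MemLp (fun x : ℝ => Complex.exp (Complex.I * S.alpha n * x)) 2 S.lineMeasure :=
    S.memLp_line (by fun_prop) 2
  have hinner : ∀ f : Lp ℂ 2 S.lineMeasure,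
      S.qpFourierCoeff f n = (S.L : ℂ)⁻¹ * inner ℂ (hexp.toLp _) f := fun f => by
    rw [qpFourierCoeff, L2.inner_def]
    congr 1
    refine integral_congr_ae (hexp.coeFn_toLp.mono fun x hx => ?_)
    simp [hx, ← Complex.exp_conj]
  simp only [hinner]
  fun_prop

/-- The directional derivative of `g` in the direction `v`. -/
abbrev dirDeriv (v : ℝ × ℝ) (g : ℝ × ℝ → ℂ) (p : ℝ × ℝ) : ℂ := fderiv ℝ g p v

/-- The Fourier coefficient `gₙ(t)` of the horizontal section of `g` at height `t`. -/
def mode (g : ℝ × ℝ → ℂ) (n : ℤ) (t : ℝ) : ℂ := S.qpFourierCoeff (fun x => g (x, t)) n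

theorem mode_eq_intervalIntegral (g : ℝ × ℝ → ℂ) (n : ℤ) (t : ℝ) :
    S.mode g n t = (S.L : ℂ)⁻¹ *
      ∫ x in (0 : ℝ)..S.L, g (x, t) * Complex.exp (-(Complex.I * S.alpha n * x)) := by
  rw [mode, qpFourierCoeff, integral_lineMeasure]

theorem continuous_mode {g : ℝ × ℝ → ℂ} (hg : Continuous g) (n : ℤ) : Continuous (S.mode g n) := by
  simp only [funext (S.mode_eq_intervalIntegral g n)]
  exact continuous_const.mul
    (intervalIntegral.continuous_parametric_intervalIntegral_of_continuous' (by fun_prop) _ _)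

theorem hasDerivAt_mode {g : ℝ × ℝ → ℂ} (hg : ContDiff ℝ 1 g) (n : ℤ) (t : ℝ) :
    HasDerivAt (S.mode g n) (S.mode (dirDeriv (0, 1) g) n t) t := by
  have hgc : Continuous g := hg.continuous
  have hdc : Continuous (dirDeriv (0, 1) g) :=
    (hg.continuous_fderiv one_ne_zero).clm_apply continuous_const
  obtain ⟨K, hK⟩ := (isCompact_Icc (a := (0 : ℝ)) (b := S.L)).prod
    (isCompact_closedBall t 1) |>.exists_bound_of_continuousOn hdc.continuousOn
  rw [funext (S.mode_eq_intervalIntegral g n), mode_eq_intervalIntegral]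
  refine HasDerivAt.const_mul _ (intervalIntegral.hasDerivAt_integral_of_dominated_loc_of_deriv_le
    (s := Metric.ball t 1) (bound := fun _ => K) (Metric.ball_mem_nhds t one_pos)
    (F' := fun s x => dirDeriv (0, 1) g (x, s) * Complex.exp (-(Complex.I * S.alpha n * x)))
    (.of_forall fun s => Continuous.aestronglyMeasurable (by fun_prop))
    (Continuous.intervalIntegrable (by fun_prop) _ _)
    (Continuous.aestronglyMeasurable (by fun_prop)) (.of_forall fun x hx s hs => ?_) (by simp)
    (.of_forall fun x _ s _ => ?_)).2
  · rw [norm_mul, norm_exp_neg_I_mul_alpha, mul_one]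
    rw [Set.uIoc_of_le S.L_pos.le] at hx
    exact hK (x, s) ⟨⟨hx.1.le, hx.2⟩, Metric.ball_subset_closedBall hs⟩
  · exact ((hg.differentiable one_ne_zero (x, s)).hasFDerivAt.comp_hasDerivAt s
      ((hasDerivAt_const s x).prodMk (hasDerivAt_id s))).mul_const _

theorem mode_dirDeriv_fst (φ : S.smoothQP) (n : ℤ) (t : ℝ) :
    S.mode (dirDeriv (1, 0) φ) n t = Complex.I * S.alpha n * S.mode φ n t := by
  have hdc : Continuous (dirDeriv (1, 0) φ) := smoothQP_continuous_deriv φ (1, 0)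
  have hderiv : ∀ x, HasDerivAt (fun x => φ.1 (x, t)) (dirDeriv (1, 0) φ (x, t)) x := fun x =>
    (smoothQP_differentiable φ (x, t)).hasFDerivAt.comp_hasDerivAt x
      ((hasDerivAt_id x).prodMk (hasDerivAt_const x t))
  have hL : (S.L : ℂ) ≠ 0 := by exact_mod_cast S.L_pos.ne'
  have hphase : Complex.I * S.alpha n * S.L =
      Complex.I * S.alpha 0 * S.L + n * (2 * Real.pi * Complex.I) := by
    simp only [alpha]
    push_cast
    field_simp
    ring
  have hqp : φ.1 (S.L, t) = Complex.exp (Complex.I * S.alpha n * S.L) * φ.1 (0, t) := by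
    rw [hphase, Complex.exp_add, Complex.exp_int_mul_two_pi_mul_I, mul_one, ← φ.2.2, zero_add]
  rw [mode_eq_intervalIntegral, mode_eq_intervalIntegral,
    integral_deriv_mul_exp_of_quasiperiodic hderiv (by fun_prop) hqp]
  ring

theorem cellMeasure_eq_prod :
    S.cellMeasure = S.lineMeasure.prod (volume.restrict (Set.Ioo (-S.H) S.H)) := by
  rw [Measure.prod_restrict]
  rfl

theorem integral_cellMeasure {f : ℝ × ℝ → ℝ} (hf : Integrable f S.cellMeasure) :
    ∫ p, f p ∂S.cellMeasure = ∫ t in (-S.H)..S.H, ∫ x, f (x, t) ∂S.lineMeasure := by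
  rw [cellMeasure_eq_prod] at hf ⊢
  rw [integral_prod_symm f hf, intervalIntegral.integral_of_le (by linarith [S.H_pos]),
    integral_Ioc_eq_integral_Ioo]

theorem hasSum_integral_sq_norm_mode {g : ℝ × ℝ → ℂ} (hg : Continuous g) :
    HasSum (fun n => S.L * ∫ t in (-S.H)..S.H, ‖S.mode g n t‖ ^ 2)
      (∫ p, ‖g p‖ ^ 2 ∂S.cellMeasure) := by
  have hparseval : ∀ t, HasSum (fun n => S.L * ‖S.mode g n t‖ ^ 2)
      (∫ x, ‖g (x, t)‖ ^ 2 ∂S.lineMeasure) := fun t =>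
    S.hasSum_sq_norm_qpFourierCoeff (S.memLp_line (by fun_prop) 2)
  have hsum : Continuous fun t => ∑' n, S.L * ‖S.mode g n t‖ ^ 2 := by
    simp only [(hparseval _).tsum_eq, integral_lineMeasure]
    exact intervalIntegral.continuous_parametric_intervalIntegral_of_continuous'
      (by fun_prop) _ _
  have hcont : ∀ n, Continuous fun t => S.L * ‖S.mode g n t‖ ^ 2 := fun n =>
    continuous_const.mul ((S.continuous_mode hg n).norm.pow 2)
  rw [S.integral_cellMeasure
    ((memLp_two_iff_integrable_sq_norm hg.aestronglyMeasurable).1 (S.memLp_cell hg 2))]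
  simp only [← intervalIntegral.integral_const_mul]
  exact intervalIntegral.hasSum_integral_of_dominated_convergence
    (fun n t => S.L * ‖S.mode g n t‖ ^ 2) (fun n => (hcont n).aestronglyMeasurable)
    (fun n => .of_forall fun t _ =>
      (Real.norm_of_nonneg (mul_nonneg S.L_pos.le (sq_nonneg _))).le)
    (.of_forall fun t _ => (hparseval t).summable) (hsum.intervalIntegrable _ _)
    (.of_forall fun t _ => hparseval t)

variable {S}

theorem hasSum_sq_norm_val_ofSmooth (φ : S.smoothQP) :
    HasSum (fun n => S.L * ∫ t in (-S.H)..S.H, ‖S.mode φ n t‖ ^ 2)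
      (‖val (S.ofSmooth φ)‖ ^ 2) := by
  convert S.hasSum_integral_sq_norm_mode (smoothQP_continuous φ) using 1
  exact sq_norm_toLp (S.memLp_cell (smoothQP_continuous φ) 2)

theorem hasSum_sq_norm_d1_ofSmooth (φ : S.smoothQP) :
    HasSum (fun n => S.L * (S.alpha n ^ 2 * ∫ t in (-S.H)..S.H, ‖S.mode φ n t‖ ^ 2))
      (‖d1 (S.ofSmooth φ)‖ ^ 2) := by
  convert S.hasSum_integral_sq_norm_mode (smoothQP_continuous_deriv φ (1, 0)) using 1
  · ext n
    simp_rw [S.mode_dirDeriv_fst φ n, norm_mul, Complex.norm_I, one_mul, mul_pow,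
      Complex.norm_real, Real.norm_eq_abs, sq_abs, intervalIntegral.integral_const_mul]
  · exact sq_norm_toLp (S.memLp_cell (smoothQP_continuous_deriv φ (1, 0)) 2)

theorem hasSum_sq_norm_d2_ofSmooth (φ : S.smoothQP) :
    HasSum (fun n => S.L * ∫ t in (-S.H)..S.H, ‖S.mode (dirDeriv (0, 1) φ) n t‖ ^ 2)
      (‖d2 (S.ofSmooth φ)‖ ^ 2) := by
  convert S.hasSum_integral_sq_norm_mode (smoothQP_continuous_deriv φ (0, 1)) using 1
  exact sq_norm_toLp (S.memLp_cell (smoothQP_continuous_deriv φ (0, 1)) 2)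

theorem continuous_coeff (s : ℝ) (n : ℤ) : Continuous fun w : S.H1qp => coeff s w n :=
  (S.continuous_qpFourierCoeff n).comp (S.trace s).continuous

theorem coeff_ofSmooth {s : ℝ} (hs : s ∈ Set.Icc (-S.H) S.H) (φ : S.smoothQP) (n : ℤ) :
    coeff s (S.ofSmooth φ) n = S.mode φ n s := by
  change S.qpFourierCoeff (S.trace s (S.ofSmooth φ)) n = _
  rw [S.trace_ofSmooth hs]
  exact S.qpFourierCoeff_congr_ae
    (S.memLp_line ((smoothQP_continuous φ).comp (by fun_prop : Continuous fun x => (x, s)))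
      2).coeFn_toLp n

variable (S) in
theorem H_mem_Icc : S.H ∈ Set.Icc (-S.H) S.H := Set.right_mem_Icc.2 (by linarith [S.H_pos])

variable (S) in
theorem neg_H_mem_Icc : -S.H ∈ Set.Icc (-S.H) S.H := Set.left_mem_Icc.2 (by linarith [S.H_pos])

theorem continuous_val : Continuous (val : S.H1qp → S.L2Cell) := by unfold val; fun_prop

theorem continuous_d1 : Continuous (d1 : S.H1qp → S.L2Cell) := by unfold d1; fun_prop

theorem continuous_d2 : Continuous (d2 : S.H1qp → S.L2Cell) := by unfold d2; fun_prop

theorem hasSum_sq_norm_ofSmooth (φ : S.smoothQP) :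
    HasSum (fun n => S.L * ((∫ t in (-S.H)..S.H, ‖S.mode φ n t‖ ^ 2) +
        (S.alpha n ^ 2 * ∫ t in (-S.H)..S.H, ‖S.mode φ n t‖ ^ 2) +
        ∫ t in (-S.H)..S.H, ‖S.mode (dirDeriv (0, 1) φ) n t‖ ^ 2))
      (‖S.ofSmooth φ‖ ^ 2) := by
  simp only [mul_add]
  rw [norm_sq_eq, seminormSq, ← add_assoc]
  exact ((hasSum_sq_norm_val_ofSmooth φ).add (hasSum_sq_norm_d1_ofSmooth φ)).add
    (hasSum_sq_norm_d2_ofSmooth φ)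

theorem sum_one_add_abs_mul_sq_norm_coeff_le {s : ℝ} (hs : s ∈ Set.Icc (-S.H) S.H) (w : S.H1qp)
    (F : Finset ℤ) :
    2 * S.H * S.L * ∑ n ∈ F, (1 + |S.alpha n|) * ‖coeff s w n‖ ^ 2 ≤
      (2 + 4 * S.H) * ‖w‖ ^ 2 := by
  have hL := S.L_pos
  have hH := S.H_pos
  have hcoeff := continuous_coeff (S := S) s
  refine S.denseRange_ofSmooth.induction_on w (isClosed_le (by fun_prop) (by fun_prop)) fun φ => ?_
  have hparseval := (hasSum_sq_norm_ofSmooth φ).mul_left (2 + 4 * S.H)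
  have hterm : ∀ n, 2 * S.H * S.L * ((1 + |S.alpha n|) * ‖S.mode φ n s‖ ^ 2) ≤
      (2 + 4 * S.H) * (S.L * ((∫ t in (-S.H)..S.H, ‖S.mode φ n t‖ ^ 2) +
        (S.alpha n ^ 2 * ∫ t in (-S.H)..S.H, ‖S.mode φ n t‖ ^ 2) +
        ∫ t in (-S.H)..S.H, ‖S.mode (dirDeriv (0, 1) φ) n t‖ ^ 2)) := fun n => by
    linarith [mul_le_mul_of_nonneg_left (one_add_abs_mul_sq_norm_le_integral
      (S.hasDerivAt_mode (φ.2.1.of_le (by simp)) n)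
      (S.continuous_mode (smoothQP_continuous_deriv φ (0, 1)) n) hs (S.alpha n)) hL.le]
  simp only [coeff_ofSmooth hs, Finset.mul_sum]
  exact (Finset.sum_le_sum fun n _ => hterm n).trans
    (sum_le_hasSum F (fun n _ => le_trans (by positivity) (hterm n)) hparseval)

theorem summable_one_add_abs_mul_sq_norm_coeff {s : ℝ} (hs : s ∈ Set.Icc (-S.H) S.H)
    (w : S.H1qp) : Summable fun n => (1 + |S.alpha n|) * ‖coeff s w n‖ ^ 2 := by
  have hL := S.L_pos
  have hH := S.H_pos
  refine summable_of_sum_le (c := (2 + 4 * S.H) * ‖w‖ ^ 2 / (2 * S.H * S.L))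
    (fun n => by positivity) fun F => ?_
  rw [le_div_iff₀' (by positivity)]
  exact sum_one_add_abs_mul_sq_norm_coeff_le hs w F

/-! ### Boundary integrals -/

theorem beta_re (e : ℝ) (n : ℤ) : (S.beta e n).re = √(S.κ ^ 2 * e - S.alpha n ^ 2) := by
  unfold beta
  split_ifs with h
  · exact Complex.ofReal_re _
  · simp [Real.sqrt_eq_zero_of_nonpos (sub_nonpos.2 (not_lt.1 h))]

theorem beta_im (e : ℝ) (n : ℤ) : (S.beta e n).im = √(S.alpha n ^ 2 - S.κ ^ 2 * e) := by
  unfold beta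
  split_ifs with h
  · simp [Real.sqrt_eq_zero_of_nonpos (sub_nonpos.2 h.le)]
  · simp

theorem sq_beta (e : ℝ) (n : ℤ) :
    S.beta e n ^ 2 = ((S.κ ^ 2 * e - S.alpha n ^ 2 : ℝ) : ℂ) := by
  unfold beta
  split_ifs with h
  · rw [← Complex.ofReal_pow, Real.sq_sqrt (sub_nonneg.2 h.le)]
  · rw [mul_pow, ← Complex.ofReal_pow, Real.sq_sqrt (sub_nonneg.2 (not_lt.1 h)), Complex.I_sq,
      neg_one_mul, ← Complex.ofReal_neg, neg_sub]

theorem norm_beta_le (e : ℝ) (n : ℤ) : ‖S.beta e n‖ ≤ S.κ * √|e| + |S.alpha n| := by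
  have hκ := S.κ_pos
  refine le_of_sq_le_sq ?_ (by positivity)
  calc ‖S.beta e n‖ ^ 2 = |S.κ ^ 2 * e - S.alpha n ^ 2| := by
        rw [← norm_pow, sq_beta, Complex.norm_real, Real.norm_eq_abs]
    _ ≤ (S.κ * √|e|) ^ 2 + |S.alpha n| ^ 2 := by
        refine (abs_sub _ _).trans_eq ?_
        rw [abs_mul, abs_pow, abs_pow, abs_of_pos hκ, mul_pow, Real.sq_sqrt (abs_nonneg e)]
    _ ≤ (S.κ * √|e| + |S.alpha n|) ^ 2 := by
        linarith [mul_nonneg (by positivity : 0 ≤ S.κ * √|e|) (abs_nonneg (S.alpha n))]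

theorem summable_dtnTerm (e : ℝ) {s : ℝ} (hs : s ∈ Set.Icc (-S.H) S.H) (w v : S.H1qp) :
    Summable (dtnTerm e s w v) := by
  have hL := S.L_pos
  have hκ := S.κ_pos
  refine Summable.of_norm_bounded
    (((summable_one_add_abs_mul_sq_norm_coeff hs w).add
      (summable_one_add_abs_mul_sq_norm_coeff hs v)).mul_left
      (S.L * |e|⁻¹ * (1 + S.κ * √|e|))) fun n => ?_
  calc ‖dtnTerm e s w v n‖
      = S.L * |e|⁻¹ * (‖S.beta e n‖ * (‖coeff s w n‖ * ‖coeff s v n‖)) := by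
        simp only [dtnTerm, dtnCoeff, norm_mul, norm_div, Complex.norm_I, Complex.norm_real,
          RCLike.norm_conj, Real.norm_eq_abs, abs_of_pos hL]
        ring
    _ ≤ S.L * |e|⁻¹ * ((1 + S.κ * √|e|) * (1 + |S.alpha n|) *
          (‖coeff s w n‖ ^ 2 + ‖coeff s v n‖ ^ 2)) := by
        gcongr
        · nlinarith [norm_beta_le (S := S) e n, mul_nonneg (by positivity : 0 ≤ S.κ * √|e|)
            (abs_nonneg (S.alpha n))]
        · nlinarith [sq_nonneg (‖coeff s w n‖ - ‖coeff s v n‖), sq_nonneg ‖coeff s w n‖,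
            sq_nonneg ‖coeff s v n‖]
    _ = _ := by ring

theorem dtnTerm_self (e s : ℝ) (w : S.H1qp) (n : ℤ) :
    dtnTerm e s w w n =
      ((S.L * ‖coeff s w n‖ ^ 2 / e : ℝ) : ℂ) * (Complex.I * S.beta e n) := by
  rw [Complex.ofReal_div, Complex.ofReal_mul, Complex.ofReal_pow, ← Complex.mul_conj', dtnTerm,
    dtnCoeff]
  ring

theorem dtnTerm_self_im (e s : ℝ) (w : S.H1qp) (n : ℤ) :
    (dtnTerm e s w w n).im =
      S.L * ‖coeff s w n‖ ^ 2 / e * √(S.κ ^ 2 * e - S.alpha n ^ 2) := by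
  rw [dtnTerm_self, Complex.im_ofReal_mul, Complex.I_mul_im, beta_re]

theorem dtnTerm_self_re (e s : ℝ) (w : S.H1qp) (n : ℤ) :
    (dtnTerm e s w w n).re =
      -(S.L * ‖coeff s w n‖ ^ 2 / e * √(S.alpha n ^ 2 - S.κ ^ 2 * e)) := by
  rw [dtnTerm_self, Complex.re_ofReal_mul, Complex.I_mul_re, beta_im, mul_neg]

theorem sum_dtnTerm_self_im_le {e s : ℝ} (he : 0 ≤ e) (hs : s ∈ Set.Icc (-S.H) S.H) (w : S.H1qp)
    (F : Finset ℤ) : ∑ n ∈ F, (dtnTerm e s w w n).im ≤ (dtnForm e s w w).im := by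
  have hL := S.L_pos
  refine sum_le_hasSum F (fun n _ => ?_) (Complex.hasSum_im (summable_dtnTerm e hs w w).hasSum)
  rw [dtnTerm_self_im]
  positivity

theorem dtnForm_self_im_nonneg {e s : ℝ} (he : 0 ≤ e) (hs : s ∈ Set.Icc (-S.H) S.H)
    (w : S.H1qp) : 0 ≤ (dtnForm e s w w).im := by
  simpa using sum_dtnTerm_self_im_le he hs w ∅

theorem dtnForm_self_re_nonpos {e s : ℝ} (he : 0 ≤ e) (hs : s ∈ Set.Icc (-S.H) S.H)
    (w : S.H1qp) : (dtnForm e s w w).re ≤ 0 := by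
  have hL := S.L_pos
  rw [dtnForm, Complex.re_tsum (summable_dtnTerm e hs w w)]
  refine tsum_nonpos fun n => ?_
  rw [dtnTerm_self_re, neg_nonpos]
  positivity

/-! ### Poincaré inequality -/

variable (S) in
theorem finite_setOf_sq_alpha_lt (δ : ℝ) : {n | S.alpha n ^ 2 < δ}.Finite := by
  have hstep : 0 < 2 * Real.pi / S.L := div_pos Real.two_pi_pos S.L_pos
  let a := S.κ * √S.epsTop * Real.sin S.θ
  refine (Set.finite_Icc ⌊(-√δ - a) / (2 * Real.pi / S.L)⌋
    ⌈(√δ - a) / (2 * Real.pi / S.L)⌉).subset fun n hn => ?_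
  have hα : S.alpha n = a + n * (2 * Real.pi / S.L) := rfl
  obtain ⟨hlow, hhigh⟩ := abs_lt.1 (Real.lt_sqrt_of_sq_lt ((sq_abs _).trans_lt hn))
  rw [hα] at hlow hhigh
  refine ⟨Int.cast_le.1 ((Int.floor_le _).trans ?_), Int.cast_le.1 (le_trans ?_ (Int.le_ceil _))⟩
  · rw [div_le_iff₀ hstep]
    linarith
  · rw [le_div_iff₀ hstep]
    linarith

variable (S) in
/-- The finitely many modes with `αₙ² < δ`, which the horizontal derivative does not control. -/
def lowModes (δ : ℝ) : Finset ℤ := (S.finite_setOf_sq_alpha_lt δ).toFinset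

theorem mem_lowModes {δ : ℝ} {n : ℤ} : n ∈ S.lowModes δ ↔ S.alpha n ^ 2 < δ :=
  Set.Finite.mem_toFinset _

theorem integral_sq_norm_mode_le (φ : S.smoothQP) {δ : ℝ} (hδ : 0 < δ) (n : ℤ) :
    ∫ t in (-S.H)..S.H, ‖S.mode φ n t‖ ^ 2 ≤
      δ⁻¹ * (S.alpha n ^ 2 * ∫ t in (-S.H)..S.H, ‖S.mode φ n t‖ ^ 2) +
      16 * S.H ^ 2 * (∫ t in (-S.H)..S.H, ‖S.mode (dirDeriv (0, 1) φ) n t‖ ^ 2) +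
      if n ∈ S.lowModes δ then 4 * S.H * ‖S.mode φ n S.H‖ ^ 2 else 0 := by
  have hH := S.H_pos
  have hnonneg : ∀ f : ℝ → ℂ, 0 ≤ ∫ t in (-S.H)..S.H, ‖f t‖ ^ 2 := fun f =>
    intervalIntegral.integral_nonneg (by linarith) fun t _ => sq_nonneg _
  have hmode := hnonneg (S.mode φ n)
  have hderiv := hnonneg (S.mode (dirDeriv (0, 1) φ) n)
  split_ifs with hn
  · have h := integral_sq_norm_le_of_hasDerivAt (S.hasDerivAt_mode (φ.2.1.of_le (by simp)) n)
      (S.continuous_mode (smoothQP_continuous_deriv φ (0, 1)) n)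
      (by linarith : -S.H ≤ S.H)
    have : 0 ≤ δ⁻¹ * (S.alpha n ^ 2 * ∫ t in (-S.H)..S.H, ‖S.mode φ n t‖ ^ 2) := by positivity
    linarith
  · rw [mem_lowModes, not_lt, ← one_le_inv_mul₀ hδ] at hn
    have : 0 ≤ 16 * S.H ^ 2 * ∫ t in (-S.H)..S.H, ‖S.mode (dirDeriv (0, 1) φ) n t‖ ^ 2 := by
      positivity
    linarith [mul_le_mul_of_nonneg_right hn hmode]

theorem sq_norm_val_le_add_sum_lowModes {δ : ℝ} (hδ : 0 < δ) (w : S.H1qp) :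
    ‖val w‖ ^ 2 ≤ δ⁻¹ * ‖d1 w‖ ^ 2 + 16 * S.H ^ 2 * ‖d2 w‖ ^ 2 +
      4 * S.H * (S.L * ∑ n ∈ S.lowModes δ, ‖coeff S.H w n‖ ^ 2) := by
  have hval := continuous_val (S := S)
  have hd1 := continuous_d1 (S := S)
  have hd2 := continuous_d2 (S := S)
  have hcoeff := continuous_coeff (S := S) S.H
  refine S.denseRange_ofSmooth.induction_on w (isClosed_le (by fun_prop) (by fun_prop)) fun φ => ?_
  have hlow : HasSum (fun n => S.L *
        if n ∈ S.lowModes δ then 4 * S.H * ‖S.mode φ n S.H‖ ^ 2 else 0)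
      (4 * S.H * (S.L * ∑ n ∈ S.lowModes δ, ‖S.mode φ n S.H‖ ^ 2)) := by
    have h := hasSum_sum_of_ne_finset_zero (L := .unconditional ℤ) (s := S.lowModes δ)
      (f := fun n => S.L * if n ∈ S.lowModes δ then 4 * S.H * ‖S.mode φ n S.H‖ ^ 2 else 0)
      fun n hn => by rw [if_neg hn, mul_zero]
    rwa [Finset.sum_congr rfl fun n hn => by rw [if_pos hn, mul_left_comm], ← Finset.mul_sum,
      ← Finset.mul_sum] at h
  simp only [coeff_ofSmooth S.H_mem_Icc]
  refine hasSum_le (fun n => ?_) (hasSum_sq_norm_val_ofSmooth φ)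
    ((((hasSum_sq_norm_d1_ofSmooth φ).mul_left δ⁻¹).add
      ((hasSum_sq_norm_d2_ofSmooth φ).mul_left (16 * S.H ^ 2))).add hlow)
  linarith [mul_le_mul_of_nonneg_left (integral_sq_norm_mode_le φ hδ n) S.L_pos.le]

theorem sqrt_mul_sum_lowModes_le {e s : ℝ} (he : 0 < e) (hs : s ∈ Set.Icc (-S.H) S.H) (δ : ℝ)
    (w : S.H1qp) :
    √δ * (S.L * ∑ n ∈ S.lowModes (S.κ ^ 2 * e - δ), ‖coeff s w n‖ ^ 2) ≤
      e * (dtnForm e s w w).im := by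
  have hL := S.L_pos
  rw [← div_le_iff₀' he]
  refine le_trans ?_ (sum_dtnTerm_self_im_le he.le hs w (S.lowModes (S.κ ^ 2 * e - δ)))
  rw [Finset.mul_sum, Finset.mul_sum, Finset.sum_div]
  refine Finset.sum_le_sum fun n hn => ?_
  rw [dtnTerm_self_im, mul_comm (√δ), mul_div_right_comm]
  gcongr
  linarith [mem_lowModes.1 hn]

variable (S) in
theorem exists_sq_norm_val_le : ∃ C : ℝ, 0 < C ∧ ∀ w : S.H1qp,
    ‖val w‖ ^ 2 ≤ C * (seminormSq w + (dtnForm S.epsTop S.H w w).im) := by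
  have hH := S.H_pos
  have hκ := S.κ_pos
  have he := S.epsTop_pos
  set δ := S.κ ^ 2 * S.epsTop / 2 with hδ_def
  have hδ : 0 < δ := by positivity
  set a := δ⁻¹
  set b := 16 * S.H ^ 2
  set c := 4 * S.H * (S.epsTop / √δ)
  have ha : 0 < a := by positivity
  have hb : 0 < b := by positivity
  have hc : 0 < c := by positivity
  refine ⟨a + b + c, by positivity, fun w => ?_⟩
  have hlow := sqrt_mul_sum_lowModes_le he S.H_mem_Icc δ w
  rw [show S.κ ^ 2 * S.epsTop - δ = δ by rw [hδ_def]; ring, ← le_div_iff₀' (Real.sqrt_pos.2 hδ),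
    mul_div_right_comm] at hlow
  have him := dtnForm_self_im_nonneg he.le S.H_mem_Icc w
  calc ‖val w‖ ^ 2
      ≤ a * ‖d1 w‖ ^ 2 + b * ‖d2 w‖ ^ 2 +
          4 * S.H * (S.epsTop / √δ * (dtnForm S.epsTop S.H w w).im) :=
        (sq_norm_val_le_add_sum_lowModes hδ w).trans (by gcongr)
    _ = a * ‖d1 w‖ ^ 2 + b * ‖d2 w‖ ^ 2 + c * (dtnForm S.epsTop S.H w w).im := by ring
    _ ≤ (a + b + c) * ‖d1 w‖ ^ 2 + (a + b + c) * ‖d2 w‖ ^ 2 +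
          (a + b + c) * (dtnForm S.epsTop S.H w w).im := by gcongr <;> linarith
    _ = (a + b + c) * (seminormSq w + (dtnForm S.epsTop S.H w w).im) := by
        rw [seminormSq]
        ring

/-! ### Coercivity -/

instance : NeZero S.cellMeasure where
  out := by
    rw [Ne, Measure.restrict_eq_zero, cell, Measure.volume_eq_prod, Measure.prod_prod]
    simp [S.L_pos, S.H_pos]

theorem sq_norm_eq_integral (f : S.L2Cell) : ‖f‖ ^ 2 = ∫ p, ‖f p‖ ^ 2 ∂S.cellMeasure := by
  rw [← sq_norm_toLp (Lp.memLp f), Lp.toLp_coeFn]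

theorem integrable_sq_norm (f : S.L2Cell) : Integrable (fun p => ‖f p‖ ^ 2) S.cellMeasure :=
  (memLp_two_iff_integrable_sq_norm (Lp.aestronglyMeasurable f)).1 (Lp.memLp f)

/-- The integrand `|∇w|²` of the squared `H¹(Ω)` seminorm. -/
def energyDensity (w : S.H1qp) (p : ℝ × ℝ) : ℝ := ‖d1 w p‖ ^ 2 + ‖d2 w p‖ ^ 2

theorem energyDensity_nonneg (w : S.H1qp) (p : ℝ × ℝ) : 0 ≤ energyDensity w p :=
  add_nonneg (sq_nonneg _) (sq_nonneg _)

theorem integrable_energyDensity (w : S.H1qp) : Integrable (energyDensity w) S.cellMeasure :=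
  (integrable_sq_norm _).add (integrable_sq_norm _)

theorem integral_energyDensity (w : S.H1qp) :
    ∫ p, energyDensity w p ∂S.cellMeasure = seminormSq w := by
  rw [seminormSq, sq_norm_eq_integral, sq_norm_eq_integral]
  exact integral_add (integrable_sq_norm _) (integrable_sq_norm _)

/-- The integral of `|∇w|²` over the cell against a complex weight `q`, in applications `1 / ε`. -/
def weightedEnergy (q : ℝ × ℝ → ℂ) (w : S.H1qp) : ℂ :=
  ∫ p, q p * (energyDensity w p : ℂ) ∂S.cellMeasure

section WeightedEnergy

variable {q : ℝ × ℝ → ℂ}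

theorem integrable_mul_energyDensity (hq : MemLp q ∞ S.cellMeasure) (w : S.H1qp) :
    Integrable (fun p => q p * (energyDensity w p : ℂ)) S.cellMeasure :=
  (integrable_energyDensity w).ofReal.mul_of_top_right hq

theorem mul_seminormSq_le_re_weightedEnergy (hq : MemLp q ∞ S.cellMeasure) {a : ℝ}
    (ha : ∀ᵐ p ∂S.cellMeasure, a ≤ (q p).re) (w : S.H1qp) :
    a * seminormSq w ≤ (weightedEnergy q w).re := by
  have hint := integrable_mul_energyDensity hq w
  rw [← integral_energyDensity, ← integral_const_mul, weightedEnergy, ← RCLike.re_eq_complex_re,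
    ← integral_re hint]
  refine integral_mono_ae ((integrable_energyDensity w).const_mul a) hint.re
    (ha.mono fun p hp => ?_)
  simp only [RCLike.re_eq_complex_re, Complex.re_mul_ofReal]
  exact mul_le_mul_of_nonneg_right hp (energyDensity_nonneg w p)

theorem mul_seminormSq_le_neg_im_weightedEnergy (hq : MemLp q ∞ S.cellMeasure) {a : ℝ}
    (ha : ∀ᵐ p ∂S.cellMeasure, a ≤ -(q p).im) (w : S.H1qp) :
    a * seminormSq w ≤ -(weightedEnergy q w).im := by
  have hrotate : weightedEnergy (fun p => Complex.I * q p) w = Complex.I * weightedEnergy q w := by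
    simp only [weightedEnergy, mul_assoc, integral_const_mul]
  have h := mul_seminormSq_le_re_weightedEnergy (hq.const_mul Complex.I)
    (ha.mono fun p hp => hp.trans_eq (Complex.I_mul_re _).symm) w
  rwa [hrotate, Complex.I_mul_re] at h

end WeightedEnergy

section Form

variable {ε : ℝ × ℝ → ℂ}

theorem form_self (hε : MemLp (fun p => (ε p)⁻¹) ∞ S.cellMeasure) (w : S.H1qp) :
    form ε w w = weightedEnergy (fun p => (ε p)⁻¹) w - ((S.κ ^ 2 * ‖val w‖ ^ 2 : ℝ) : ℂ) -
      dtnForm S.epsBot (-S.H) w w - dtnForm S.epsTop S.H w w := by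
  have hmass : Integrable (fun p => ((S.κ ^ 2 * ‖val w p‖ ^ 2 : ℝ) : ℂ)) S.cellMeasure :=
    ((integrable_sq_norm (val w)).const_mul _).ofReal
  rw [sq_norm_eq_integral, ← integral_const_mul, ← integral_complex_ofReal, weightedEnergy,
    ← integral_sub (integrable_mul_energyDensity hε w) hmass, form]
  congr 3 with p
  simp only [Complex.mul_conj', energyDensity]
  push_cast
  rfl

theorem mul_sq_norm_le_re_form_self_add (hε : MemLp (fun p => (ε p)⁻¹) ∞ S.cellMeasure) {a : ℝ}
    (ha1 : a ≤ 1) (ha : ∀ᵐ p ∂S.cellMeasure, a ≤ ((ε p)⁻¹).re) (w : S.H1qp) :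
    a * ‖w‖ ^ 2 ≤ (form ε w w).re + S.gam * ‖val w‖ ^ 2 := by
  have henergy := mul_seminormSq_le_re_weightedEnergy hε ha w
  have hmass : a * ‖val w‖ ^ 2 ≤ ‖val w‖ ^ 2 := mul_le_of_le_one_left (sq_nonneg _) ha1
  have hbot := dtnForm_self_re_nonpos S.epsBot_pos.le S.neg_H_mem_Icc w
  have htop := dtnForm_self_re_nonpos S.epsTop_pos.le S.H_mem_Icc w
  rw [form_self hε, norm_sq_eq, gam, Complex.sub_re, Complex.sub_re, Complex.sub_re,
    Complex.ofReal_re]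
  linarith

theorem mul_seminormSq_add_le_neg_im_form_self (hε : MemLp (fun p => (ε p)⁻¹) ∞ S.cellMeasure)
    {b : ℝ} (hb1 : b ≤ 1) (hb : ∀ᵐ p ∂S.cellMeasure, b ≤ -((ε p)⁻¹).im) (w : S.H1qp) :
    b * (seminormSq w + (dtnForm S.epsTop S.H w w).im) ≤ -(form ε w w).im := by
  have henergy := mul_seminormSq_le_neg_im_weightedEnergy hε hb w
  have hbot := dtnForm_self_im_nonneg S.epsBot_pos.le S.neg_H_mem_Icc w
  have htop := mul_le_of_le_one_left (dtnForm_self_im_nonneg S.epsTop_pos.le S.H_mem_Icc w) hb1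
  rw [form_self hε, Complex.sub_im, Complex.sub_im, Complex.sub_im, Complex.ofReal_im]
  linarith

theorem div_sqrt_mul_sq_norm_le_norm_form_self (hε : MemLp (fun p => (ε p)⁻¹) ∞ S.cellMeasure)
    {a l : ℝ} (ha01 : a ∈ Set.Ioc 0 1) (ha : ∀ᵐ p ∂S.cellMeasure, a ≤ ((ε p)⁻¹).re) (hl : 0 < l)
    {w : S.H1qp} (hw : l * ‖val w‖ ^ 2 ≤ -(form ε w w).im) :
    a / √(1 + 2 * (S.gam / l) ^ 2) * ‖w‖ ^ 2 ≤ ‖form ε w w‖ := by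
  have hgam : 0 < S.gam := add_pos_of_nonneg_of_pos (sq_nonneg _) one_pos
  rw [div_mul_eq_mul_div]
  refine div_sqrt_le_norm_of_le_re_sub_im (mul_nonneg ha01.1.le (sq_nonneg _)) ?_
  calc a * ‖w‖ ^ 2 ≤ (form ε w w).re + S.gam * ‖val w‖ ^ 2 :=
        mul_sq_norm_le_re_form_self_add hε ha01.2 ha w
    _ = (form ε w w).re + S.gam / l * (l * ‖val w‖ ^ 2) := by
        rw [← mul_assoc, div_mul_cancel₀ _ hl.ne']
    _ ≤ (form ε w w).re + S.gam / l * -(form ε w w).im := by gcongr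
    _ = (form ε w w).re - S.gam / l * (form ε w w).im := by rw [mul_neg, sub_eq_add_neg]

theorem sigma_mem_Ioc (hε : eLpNorm ε ∞ S.cellMeasure ≠ ⊤) {c : ℝ} (hc : 0 < c)
    (hre : ∀ᵐ p ∂S.cellMeasure, c < (ε p).re) : S.sigma ε ∈ Set.Ioc 0 1 := by
  obtain ⟨a, ha, hle⟩ := exists_pos_ae_le_div_sq_norm hε hc hre fun p => Complex.re_le_norm _
  exact essInf_min_one_mem_Ioc ha hle

theorem ae_sigma_le_re_inv (hre : ∀ᵐ p ∂S.cellMeasure, 0 ≤ (ε p).re) :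
    ∀ᵐ p ∂S.cellMeasure, S.sigma ε ≤ ((ε p)⁻¹).re := by
  filter_upwards [ae_essInf_min_one_le (hre.mono fun p hp => div_nonneg hp (sq_nonneg ‖ε p‖))]
    with p hp
  rw [Complex.inv_re, Complex.normSq_eq_norm_sq]
  exact hp.trans (min_le_left _ _)

theorem lam_pos (hε : eLpNorm ε ∞ S.cellMeasure ≠ ⊤) {c : ℝ} (hc : 0 < c)
    (him : ∀ᵐ p ∂S.cellMeasure, c < (ε p).im) {k : ℝ} (hk : 0 < k) : 0 < S.lam k ε := by
  obtain ⟨a, ha, hle⟩ := exists_pos_ae_le_div_sq_norm hε hc him fun p => Complex.im_le_norm _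
  exact mul_pos hk (essInf_min_one_mem_Ioc ha hle).1

theorem lam_inv_mul_sq_norm_val_le {C : ℝ} (hC : 0 < C) {w : S.H1qp}
    (hpoincare : ‖val w‖ ^ 2 ≤ C * (seminormSq w + (dtnForm S.epsTop S.H w w).im))
    (hε : eLpNorm ε ∞ S.cellMeasure ≠ ⊤) (hε_inv : MemLp (fun p => (ε p)⁻¹) ∞ S.cellMeasure) {c : ℝ}
    (hc : 0 < c) (him : ∀ᵐ p ∂S.cellMeasure, c < (ε p).im) :
    S.lam C⁻¹ ε * ‖val w‖ ^ 2 ≤ -(form ε w w).im := by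
  obtain ⟨a, ha, hle⟩ := exists_pos_ae_le_div_sq_norm hε hc him
    fun p => Complex.im_le_norm _
  set τ := essInf (fun p => min ((ε p).im / ‖ε p‖ ^ 2) 1) S.cellMeasure with hτ_def
  have hτ : τ ∈ Set.Ioc 0 1 := essInf_min_one_mem_Ioc ha hle
  have hτ_le : ∀ᵐ p ∂S.cellMeasure, τ ≤ -((ε p)⁻¹).im := by
    filter_upwards [ae_essInf_min_one_le hle] with p hp
    rw [Complex.inv_im, Complex.normSq_eq_norm_sq, neg_div, neg_neg]
    exact hp.trans (min_le_left _ _)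
  calc S.lam C⁻¹ ε * ‖val w‖ ^ 2 = τ * (C⁻¹ * ‖val w‖ ^ 2) := by rw [lam, ← hτ_def]; ring
    _ ≤ τ * (seminormSq w + (dtnForm S.epsTop S.H w w).im) :=
      mul_le_mul_of_nonneg_left ((inv_mul_le_iff₀ hC).2 hpoincare) hτ.1.le
    _ ≤ -(form ε w w).im := mul_seminormSq_add_le_neg_im_form_self hε_inv hτ.2 hτ_le w

end Form

end Setup

end RCWA

end

theorem corollary2 (S : RCWA.Setup) :
    (∀ w v : S.H1qp,
      Summable (RCWA.Setup.dtnTerm S.epsTop S.H w v) ∧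
      Summable (RCWA.Setup.dtnTerm S.epsBot (-S.H) w v)) ∧
    ∃ C : ℝ, 0 < C ∧
      (∀ w : S.H1qp, ‖RCWA.Setup.val w‖ ^ 2 ≤
        C * (RCWA.Setup.seminormSq w + (RCWA.Setup.dtnForm S.epsTop S.H w w).im)) ∧
      ∀ (ε : ℝ × ℝ → ℂ) (c₁ c₂ : ℝ), MemLp ε ∞ S.cellMeasure → 0 < c₁ → 0 < c₂ →
        (∀ᵐ p ∂S.cellMeasure, c₁ < (ε p).im) → (∀ᵐ p ∂S.cellMeasure, c₂ < (ε p).re) →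
          RCWA.Setup.Coercive (RCWA.Setup.form (S := S) ε) ∧
          0 < S.sigma ε ∧ 0 < S.lam C⁻¹ ε ∧
          ∀ w : S.H1qp,
            S.sigma ε / √(1 + 2 * (S.gam / S.lam C⁻¹ ε) ^ 2) * ‖w‖ ^ 2 ≤
              ‖RCWA.Setup.form ε w w‖ := by
  refine ⟨fun w v => ⟨RCWA.Setup.summable_dtnTerm _ S.H_mem_Icc w v,
    RCWA.Setup.summable_dtnTerm _ S.neg_H_mem_Icc w v⟩, ?_⟩
  obtain ⟨C, hC, hpoincare⟩ := S.exists_sq_norm_val_le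
  refine ⟨C, hC, hpoincare, fun ε c₁ c₂ hε hc₁ hc₂ him hre => ?_⟩
  have hε_inv : MemLp (fun p => (ε p)⁻¹) ∞ S.cellMeasure := RCWA.memLp_top_inv_of_lt_norm hε.1 hc₂
    (hre.mono fun p hp => hp.trans_le (Complex.re_le_norm _))
  have hσ := RCWA.Setup.sigma_mem_Ioc hε.eLpNorm_ne_top hc₂ hre
  have hlam := RCWA.Setup.lam_pos hε.eLpNorm_ne_top hc₁ him (inv_pos.2 hC)
  have hcoercive : ∀ w : S.H1qp,
      S.sigma ε / √(1 + 2 * (S.gam / S.lam C⁻¹ ε) ^ 2) * ‖w‖ ^ 2 ≤ ‖RCWA.Setup.form ε w w‖ :=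
    fun w => RCWA.Setup.div_sqrt_mul_sq_norm_le_norm_form_self hε_inv hσ
      (RCWA.Setup.ae_sigma_le_re_inv (hre.mono fun p hp => (hc₂.trans hp).le)) hlam
      (RCWA.Setup.lam_inv_mul_sq_norm_val_le hC (hpoincare w) hε.eLpNorm_ne_top hε_inv hc₁ him)
  exact ⟨⟨_, div_pos hσ.1 (by positivity), hcoercive⟩, hσ.1, hlam, hcoercive⟩
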